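/- Let $n\ge 1$ and $N\ge n$. A \emph{discrete multiline queue} (MLQ) of type $(1,\dots,1)$ ($n$ ones) on $N$ sites is an array with rows $1,\dots,n$ (from top to bottom) and columns $0,\dots,N-1$, with exactly $r$ boxes in row $r$. Its boxes are labelled row by row from the top. The box in row $1$ gets label $1$. When row $r$ has been labelled by $1,\dots,r$, go through its boxes in increasing order of their labels; the box with label $j$ gives the label $j$ to the first box of row $r+1$ that is not yet labelled, going weakly to the right (cyclically) from the column of the box; finally the one unlabelled box of row $r+1$ gets label $r+1$. For a permutation $\pi$ of $\{1,\dots,n\}$ and $0\le b_1<\dots<b_n\le N-1$, let $G_\pi=G_\pi(b_1,\dots,b_n;N)$ be the number of MLQs whose bottom row $n$ has its boxes in the columns $b_1<\dots<b_n$, with labels $\pi_1,\dots,\pi_n$ in this order. Let $w_0=n(n-1)\cdots 1$ and, for $1\le k<n$, let $s_kw_0=n\cdots(k+2)\,k\,(k+1)\,(k-1)\cdots 1$ be $w_0$ with the letters $k$ and $k+1$ interchanged. Let $A_k$ be the $n\times n$ matrix whose $(i,j)$ entry is $\binom{b_i+j-1}{j-1}$ if $1\le i\le n-k$, and $\binom{b_i+j-2}{j-2}$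 if $n-k<i\le n$ (read as $0$ for $j=1$). Theorem. Let $k\in\{1,2\}$, $N\ge n>k$ and $0\le b_1<\dots<b_n\le N-1$. Then \[ G_{s_kw_0}(b_1,\dots,b_n;N)=\binom{N}{k}\det A_k-G_{w_0}(b_1,\dots,b_n;N). \] -/

import Mathlib

/-- A discrete multiline queue of type `(1, …, 1)` (`n` ones) on a ring of `N` sites: an array of
rows `1, …, n` with columns `0, …, N - 1`, with exactly `r` boxes in row `r`. The function gives
the set of columns of the boxes of each row; a row `0`, which has no box, is added to make the
indexing uniform. -/
abbrev MLQ (n N : ℕ) : Type :=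
  {row : Fin (n + 1) → Finset (Fin N) // ∀ r, (row r).card = (r : ℕ)}

namespace MLQ

/-- The labelling procedure. Labels are counted from `0`: `p r k` is the column of the box with the
`k`-th label in row `r` (so this is the label `k + 1` in `1, …, r`).
The boxes of row `r` are treated in the order of their labels; the box in column `c = p r k` gives
its label to the first box of row `r + 1` that is still unlabelled (it has none of the labels
`j < k`), going cyclically and weakly to the right from column `c`. The subtraction is modulo `N`,
hence `(d - c).val` is the number of steps to the right from column `c` to column `d`.
The one box of row `r + 1` that remains gets the new label. -/
structure IsLabelling {n N : ℕ} (M : MLQ n N) (p : (r : Fin (n + 1)) → Fin r → Fin N) :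
    Prop where
  mem : ∀ (r : Fin (n + 1)) (k : Fin r), p r k ∈ M.1 r
  inj : ∀ r : Fin (n + 1), Function.Injective (p r)
  first : ∀ (r : Fin n) (k : Fin r), ∀ d ∈ M.1 r.succ,
    (∀ j : Fin (r + 1), j < k.castSucc → p r.succ j ≠ d) →
      (p r.succ k.castSucc - p r.castSucc k).val ≤ (d - p r.castSucc k).val

/-- The letters in the bottom row, read from left to right, are `w 0, w 1, …` (labels counted from
`0`), at the columns `b 0 < b 1 < …`. -/
def HasBottomRow {n N : ℕ} (M : MLQ n N) (w : Equiv.Perm (Fin n)) (b : Fin n → Fin N) : Prop :=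
  ∃ p, M.IsLabelling p ∧ ∀ i : Fin n, p (Fin.last n) (w i) = b i

/-- `G w b` is the number of multiline queues whose bottom row is `w` at the columns `b`. -/
noncomputable def G {n N : ℕ} (w : Equiv.Perm (Fin n)) (b : Fin n → Fin N) : ℕ :=
  Nat.card {M : MLQ n N // M.HasBottomRow w b}

/-- The reverse permutation `n ⋯ 2 1`. -/
def w₀ (n : ℕ) : Equiv.Perm (Fin n) := Fin.revPerm

/-- The simple transposition of the labels `k` and `k + 1` of `1, …, n`
(which are `k - 1` and `k` when counted from `0`), for `1 ≤ k < n`. -/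
def s {n : ℕ} (k : ℕ) (hk : k < n) : Equiv.Perm (Fin n) :=
  Equiv.swap ⟨k - 1, lt_of_le_of_lt (Nat.sub_le k 1) hk⟩ ⟨k, hk⟩

/-- The matrix `A_k`. With rows and columns counted from `1` its entries are
`binom (b_i + j - 1) (j - 1)` for `i ≤ n - k` and `binom (b_i + j - 2) (j - 2)` for `i > n - k`,
where the latter is `0` for `j = 1`. -/
def A {n N : ℕ} (k : ℕ) (b : Fin n → Fin N) : Matrix (Fin n) (Fin n) ℤ :=
  Matrix.of fun i j =>
    if (i : ℕ) < n - k then (((b i : ℕ) + (j : ℕ)).choose (j : ℕ) : ℤ)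
    else if (j : ℕ) = 0 then 0
    else (((b i : ℕ) + ((j : ℕ) - 1)).choose ((j : ℕ) - 1) : ℤ)

/-- One step of the procedure can always be carried out. -/
theorem exists_step {N : ℕ} (S : Finset (Fin N)) (m : ℕ) (q : Fin m → Fin N) (hm : m ≤ S.card) :
    ∃ t : Fin m → Fin N, (∀ k, t k ∈ S) ∧ Function.Injective t ∧
      ∀ k, ∀ d ∈ S, (∀ j, j < k → t j ≠ d) → (t k - q k).val ≤ (d - q k).val := by
  induction m with
  | zero => exact ⟨Fin.elim0, fun k => k.elim0, fun k => k.elim0, fun k => k.elim0⟩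
  | succ m ih =>
    obtain ⟨t, h1, h2, h3⟩ := ih (fun k => q k.castSucc) (by omega)
    have hne : (S \ Finset.univ.image t).Nonempty := by
      rw [← Finset.card_pos]
      have h4 := Finset.le_card_sdiff (Finset.univ.image t) S
      have h5 : (Finset.univ.image t).card ≤ m := by
        simpa using Finset.card_image_le (s := Finset.univ) (f := t)
      omega
    obtain ⟨d, hd, hmin⟩ := Finset.exists_min_image _ (fun d => (d - q (Fin.last m)).val) hne
    simp only [Finset.mem_sdiff, Finset.mem_image, Finset.mem_univ, true_and, not_exists] at hd hmin
    refine ⟨Fin.snoc (α := fun _ => Fin N) t d, ?_, ?_, ?_⟩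
    · intro k
      refine Fin.lastCases ?_ (fun k => ?_) k
      · simpa using hd.1
      · simpa using h1 k
    · exact Fin.snoc_injective_iff.2 ⟨h2, fun ⟨j, hj⟩ => hd.2 j hj⟩
    · intro k
      refine Fin.lastCases ?_ (fun k => ?_) k
      · intro e he hj
        simp only [Fin.snoc_last]
        refine hmin e ⟨he, fun j => ?_⟩
        simpa using hj j.castSucc (Fin.castSucc_lt_last j)
      · intro e he hj
        simp only [Fin.snoc_castSucc]
        refine h3 k e he fun j hjk => ?_
        simpa using hj j.castSucc (Fin.castSucc_lt_castSucc_iff.2 hjk)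

/-- The procedure is well defined: each multiline queue has exactly one labelling. -/
theorem existsUnique_isLabelling {n N : ℕ} (M : MLQ n N) : ∃! p, M.IsLabelling p := by
  apply existsUnique_of_exists_of_unique
  · have key : ∀ (r : Fin n) (q : Fin r → Fin N), ∃ t : Fin (r + 1) → Fin N,
        (∀ k, t k ∈ M.1 r.succ) ∧ Function.Injective t ∧
        ∀ k : Fin r, ∀ d ∈ M.1 r.succ, (∀ j : Fin (r + 1), j < k.castSucc → t j ≠ d) →
          (t k.castSucc - q k).val ≤ (d - q k).val := by
      intro r q
      have hc : (M.1 r.succ).card = (r : ℕ) + 1 := by simpa using M.2 r.succ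
      obtain ⟨c, -⟩ : (M.1 r.succ).Nonempty := by rw [← Finset.card_pos]; omega
      obtain ⟨t, h1, h2, h3⟩ := exists_step (M.1 r.succ) (r + 1)
        (Fin.snoc (α := fun _ => Fin N) q c) hc.ge
      exact ⟨t, h1, h2, fun k d hd hj => by simpa using h3 k.castSucc d hd hj⟩
    choose F hF1 hF2 hF3 using key
    refine ⟨fun r => Fin.induction (motive := fun r : Fin (n + 1) => Fin r → Fin N)
      (fun k => Fin.elim0 k) (fun r q => F r q) r, ?_, ?_, ?_⟩
    · intro r
      refine Fin.cases (fun k => Fin.elim0 k) (fun r k => ?_) r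
      exact hF1 r _ k
    · intro r
      refine Fin.cases (fun k => Fin.elim0 k) (fun r => ?_) r
      exact hF2 r _
    · intro r k d hd hj
      exact hF3 r _ k d hd hj
  · intro p p' hp hp'
    have main : ∀ r : Fin (n + 1), p r = p' r := by
      intro r
      induction r using Fin.induction with
      | zero => funext k; exact Fin.elim0 k
      | succ r ih =>
        have old : ∀ k : Fin (r + 1), ∀ hk : (k : ℕ) < r, p r.succ k = p' r.succ k := by
          intro k
          induction k using WellFoundedLT.induction with
          | _ k ihk =>
          intro hk
          have e : k = (⟨k, hk⟩ : Fin r).castSucc := rfl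
          have a := hp.first r ⟨k, hk⟩ (p' r.succ k) (hp'.mem r.succ k) (fun j hj => by
            rw [ihk j hj (lt_trans hj hk)]; exact fun h => hj.ne (hp'.inj r.succ h))
          have b := hp'.first r ⟨k, hk⟩ (p r.succ k) (hp.mem r.succ k) (fun j hj => by
            rw [← ihk j hj (lt_trans hj hk)]; exact fun h => hj.ne (hp.inj r.succ h))
          rw [← e] at a b
          rw [ih] at a
          have hN : NeZero N := ⟨fun h => by subst h; exact (p r.succ k).elim0⟩
          exact sub_left_injective (Fin.val_injective (le_antisymm a b))
        have im : ∀ q : (r : Fin (n + 1)) → Fin r → Fin N, M.IsLabelling q →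
            Finset.univ.image (q r.succ) = M.1 r.succ := by
          intro q hq
          apply Finset.eq_of_subset_of_card_le
          · intro x hx
            obtain ⟨k, -, rfl⟩ := Finset.mem_image.1 hx
            exact hq.mem _ k
          · rw [Finset.card_image_of_injective _ (hq.inj _), M.2]; simp
        funext k
        by_cases hk : (k : ℕ) < r
        · exact old k hk
        · have hm : p r.succ k ∈ Finset.univ.image (p' r.succ) := by
            rw [im p' hp']; exact hp.mem _ k
          obtain ⟨j, -, hj⟩ := Finset.mem_image.1 hm
          by_cases hjr : (j : ℕ) < r
          · rw [← old j hjr] at hj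
            exact absurd (hp.inj _ hj) (fun h => hk (h ▸ hjr))
          · have : j = k := by
              apply Fin.ext
              have h1 : (j : ℕ) < r + 1 := j.2
              have h2 : (k : ℕ) < r + 1 := k.2
              omega
            rw [← hj, this]
    exact funext main

end MLQ

/-!
A labelled row is recorded by the columns of its boxes in decreasing order of labels, so that `w₀`
corresponds to an increasing sequence `b`. Write `F(b)` (`MLQ.pairCount`) for the number of
multiline queues with bottom word `w₀` or `s_k w₀` at `b`. The claim is
`F(b) = binom(N, k) det A_k`, by induction on the number of rows.

Removing the bottom row expresses each count as a sum over the labelled rows that produce it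
(`MLQ.count_succ`). If the bottom word is `w₀`, each box above lies in its own gap
`(b_i, b_{i+1}]`, without any cyclic wrapping. If it is `s_k w₀` and `k + 1` is not the new label,
there is one more possibility: the boxes labelled `k` and `k + 1` lie in the same gap, in either
order. The words occurring above are again `w₀` and `s_k w₀`, and adding the two
counts gives a closed recursion for `F` (`MLQ.pairCount_succ`): a sum of `F(y)` over the
`y` interlacing with `b`, and a sum over the increasing `y` with two entries in the same gap.

The determinants satisfy the same recursion (`MLQ.det_A_succ`). By multilinearity the sums over
gaps become sums of rows, which telescope since the rows of `A_k` are iterated differences of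
binomial rows. For the two rows in a common gap, `sum_Ioc_telescope` evaluates the
double sum. The outcome is `det A_k` after subtracting adjacent rows.

The recursion ends at `n = k + 1`, where `k + 1` is the new label (`MLQ.pairCount_zero`): then the
two words together leave the box labelled `k` unconstrained. This gives `N` for
`k = 1` (`MLQ.pairCount_one`), and `binom(N, 2) (b_3 - b_2)` for `k = 2` by a double count of
cyclic distances (`MLQ.pairCount_two`). Only here is `k ≤ 2` used.
-/

namespace MLQ

open Finset Function

/-! ### Labelled multiline queues and removal of the bottom row -/

/-- The labelling procedure turns a row `x` into the next row `y`. A labelled row of `n` boxes is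
given by the columns `x 0, …, x (n - 1)` of its boxes in *decreasing* order of labels, so that the
word `n ⋯ 2 1` becomes an increasing `x`. The box `x i` then labels the box `y i.succ`, the boxes
with smaller labels have taken the `y j` with `j > i.succ`, and `y 0` is the new label. -/
def Feeds {n N : ℕ} (x : Fin n → Fin N) (y : Fin (n + 1) → Fin N) : Prop :=
  ∀ (i : Fin n) (j : Fin (n + 1)), j ≤ i.succ → (y i.succ - x i).val ≤ (y j - x i).val

/-- A labelled multiline queue, as the array of the columns of its boxes: `P r i` is the column of
the box of row `r` with label `r - 1 - i` (labels counted from `0`). -/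
structure IsColumnArray {n N : ℕ} (P : (r : Fin (n + 1)) → Fin r → Fin N) : Prop where
  inj : ∀ r, Injective (P r)
  feeds : ∀ r : Fin n, Feeds (n := r) (P r.castSucc) (P r.succ)

/-- The number of labelled multiline queues with bottom row `y`, the columns being listed in
decreasing order of labels. It is `0` if `y` is not injective. -/
noncomputable def count {n N : ℕ} (y : Fin n → Fin N) : ℕ :=
  Nat.card {P : (r : Fin (n + 1)) → Fin r → Fin N // IsColumnArray P ∧ P (Fin.last n) = y}

theorem IsLabelling.row_eq {n N : ℕ} {M : MLQ n N} {p : (r : Fin (n + 1)) → Fin r → Fin N}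
    (hp : M.IsLabelling p) (r : Fin (n + 1)) : M.1 r = univ.image (p r) := by
  symm
  apply Finset.eq_of_subset_of_card_le
  · intro x hx
    obtain ⟨k, -, rfl⟩ := Finset.mem_image.1 hx
    exact hp.mem _ k
  · rw [Finset.card_image_of_injective _ (hp.inj _), M.2]; simp

theorem isLabelling_iff {n N : ℕ} {M : MLQ n N} {p : (r : Fin (n + 1)) → Fin r → Fin N} :
    M.IsLabelling p ↔
      IsColumnArray (fun r i => p r i.rev) ∧ ∀ r, M.1 r = univ.image (p r) := by
  constructor
  · refine fun hp => ⟨⟨fun r => (hp.inj r).comp Fin.rev_injective, fun r i j hj => ?_⟩, hp.row_eq⟩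
    have h := hp.first r i.rev (p r.succ j.rev) (hp.mem _ _) fun l hl e => by
      have := hp.inj _ e
      subst this
      rw [Fin.lt_def] at hl
      rw [Fin.le_def] at hj
      simp [Fin.val_rev] at hl hj
      omega
    have e : (Fin.rev i.succ : Fin (r + 1)) = i.rev.castSucc := Fin.rev_succ i
    change (p r.succ (Fin.rev i.succ : Fin (r + 1)) - _).val ≤ _
    rw [e]
    exact h
  · rintro ⟨h, hM⟩
    refine ⟨fun r k => by rw [hM]; exact mem_image_of_mem _ (mem_univ _), fun r => ?_, ?_⟩
    · simpa [comp_def] using (h.inj r).comp Fin.rev_injective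
    · intro r k d hd hj
      rw [hM] at hd
      obtain ⟨l, -, rfl⟩ := Finset.mem_image.1 hd
      have hl : k.castSucc ≤ (l : Fin (r + 1)) := not_lt.1 fun hl => hj l hl rfl
      have := h.feeds r k.rev (Fin.rev (l : Fin (r + 1))) (by
        rw [Fin.le_def] at hl ⊢
        simp [Fin.val_rev] at hl ⊢
        omega)
      have e : (Fin.rev (k.rev.succ) : Fin (r + 1)) = k.castSucc := by
        rw [Fin.rev_succ, Fin.rev_rev]
      change (p r.succ (Fin.rev (k.rev.succ) : Fin (r + 1)) - p r.castSucc (Fin.rev (k.rev))).val ≤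
        (p r.succ (Fin.rev (Fin.rev (l : Fin (r + 1)))) -
          p r.castSucc (Fin.rev (k.rev))).val at this
      rw [e, Fin.rev_rev, Fin.rev_rev] at this
      exact this

/-- A multiline queue has a unique labelling, so counting queues is counting labelled queues. -/
theorem G_eq_count {n N : ℕ} (w : Equiv.Perm (Fin n)) (b : Fin n → Fin N) :
    G w b = count fun i => b (w.symm i.rev) := by
  symm
  have key : ∀ P : (r : Fin (n + 1)) → Fin r → Fin N, IsColumnArray P →
      ∀ r, (univ.image (P r)).card = (r : ℕ) := fun P hP r => by
    rw [card_image_of_injective _ (hP.inj r)]; simp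
  have lab : ∀ P : (r : Fin (n + 1)) → Fin r → Fin N, ∀ hP : IsColumnArray P,
      IsLabelling ⟨_, key P hP⟩ fun r i => P r i.rev := fun P hP => by
    rw [isLabelling_iff]
    refine ⟨by simpa using hP, fun r => ?_⟩
    ext d
    simp only [Finset.mem_image, Finset.mem_univ, true_and]
    exact ⟨fun ⟨i, hi⟩ => ⟨i.rev, by simpa using hi⟩, fun ⟨i, hi⟩ => ⟨_, hi⟩⟩
  refine Nat.card_eq_of_bijective (fun P => ⟨⟨_, key P.1 P.2.1⟩, _, lab P.1 P.2.1, fun i => ?_⟩)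
    ⟨?_, ?_⟩
  · have := congrFun P.2.2 (w i).rev
    simpa using this
  · rintro ⟨P, hP, hP'⟩ ⟨Q, hQ, hQ'⟩ h
    have h1 := lab P hP
    have h2 := lab Q hQ
    have e := congrArg Subtype.val h
    simp only at e
    rw [← e] at h2
    have h3 := (existsUnique_isLabelling _).unique h1 h2
    apply Subtype.ext
    funext r i
    simpa using congrFun (congrFun h3 r) i.rev
  · rintro ⟨M, p, hp, hb⟩
    refine ⟨⟨fun r i => p r i.rev, (isLabelling_iff.1 hp).1, ?_⟩, ?_⟩
    · funext i
      change p (Fin.last n) (i.rev : Fin n) = _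
      rw [← hb]; simp
    · apply Subtype.ext
      apply Subtype.ext
      funext r
      rw [hp.row_eq r]
      ext d
      simp only [Finset.mem_image, Finset.mem_univ, true_and]
      exact ⟨fun ⟨i, hi⟩ => ⟨_, hi⟩, fun ⟨i, hi⟩ => ⟨i.rev, by simpa using hi⟩⟩

theorem count_zero {N : ℕ} (y : Fin 0 → Fin N) : count y = 1 := by
  rw [count, Nat.card_eq_one_iff_unique]
  refine ⟨⟨fun P Q => Subtype.ext (funext fun r => ?_)⟩, ⟨fun r i => y (i.cast (by simp)), ?_, ?_⟩⟩
  · obtain rfl : r = 0 := Subsingleton.elim (α := Fin 1) _ _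
    exact funext fun i => i.elim0
  · refine ⟨fun r i => ?_, fun r => r.elim0⟩
    obtain rfl : r = 0 := Subsingleton.elim (α := Fin 1) _ _
    exact i.elim0
  · exact funext fun i => i.elim0

theorem count_eq_zero {n N : ℕ} {y : Fin n → Fin N} (hy : ¬ Injective y) : count y = 0 := by
  rw [count, Nat.card_eq_zero]
  refine Or.inl ⟨fun ⟨P, hP, e⟩ => hy ?_⟩
  rw [← e]
  exact hP.inj _

theorem isColumnArray_snoc {n N : ℕ} {P : (r : Fin (n + 1)) → Fin r → Fin N}
    {y : Fin (n + 1) → Fin N} :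
    IsColumnArray (Fin.snoc (α := fun r : Fin (n + 2) => Fin r → Fin N) P y) ↔
      IsColumnArray P ∧ Injective y ∧ Feeds (P (Fin.last n)) y := by
  let Q := Fin.snoc (α := fun r : Fin (n + 2) => Fin r → Fin N) P y
  have e (r : Fin (n + 1)) : Q r.castSucc = P r :=
    Fin.snoc_castSucc (α := fun r : Fin (n + 2) => Fin r → Fin N) y P r
  have e' : Q (Fin.last (n + 1)) = y :=
    Fin.snoc_last (α := fun r : Fin (n + 2) => Fin r → Fin N) y P
  change IsColumnArray Q ↔ _
  constructor
  · intro h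
    refine ⟨⟨fun r => e r ▸ h.inj r.castSucc, fun r => ?_⟩, e' ▸ h.inj (Fin.last _), ?_⟩
    · have := h.feeds r.castSucc
      rw [e] at this
      exact e r.succ ▸ this
    · have := h.feeds (Fin.last n)
      rw [e] at this
      exact e' ▸ this
  · rintro ⟨h, hy, hf⟩
    refine ⟨fun r => ?_, fun r => ?_⟩
    · refine Fin.lastCases ?_ (fun r => ?_) r
      · exact e'.symm ▸ hy
      · exact (e r).symm ▸ h.inj r
    · refine Fin.lastCases ?_ (fun r => ?_) r
      · rw [e]
        exact e'.symm ▸ hf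
      · rw [e]
        exact (e r.succ).symm ▸ h.feeds r

open Classical in
/-- Removing the bottom row. -/
theorem count_succ {n N : ℕ} {y : Fin (n + 1) → Fin N} (hy : Injective y) :
    count y = ∑ x with Feeds x y, count x := by
  rw [Finset.sum_subtype (p := fun x => Feeds x y) _ (by simp)]
  simp only [count]
  rw [← Nat.card_sigma]
  symm
  refine Nat.card_eq_of_bijective (fun a => ⟨Fin.snoc (α := fun r : Fin (n + 2) => Fin r → Fin N)
    a.2.1 y, isColumnArray_snoc.2 ⟨a.2.2.1, hy, ?_⟩, by simp⟩) ⟨?_, ?_⟩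
  · rw [a.2.2.2]; exact a.1.2
  · rintro ⟨⟨x, hx⟩, P, hP, e⟩ ⟨⟨x', hx'⟩, P', hP', e'⟩ h
    have h1 := congrArg Subtype.val h
    simp only at h1
    have h2 : P = P' := (Fin.snoc_inj.1 h1).1
    subst h2
    have h3 : x = x' := e.symm.trans e'
    subst h3
    rfl
  · rintro ⟨P, hP, e⟩
    have h : Fin.snoc (α := fun r : Fin (n + 2) => Fin r → Fin N) (Fin.init P) y = P := by
      rw [← e]; exact Fin.snoc_init_self P
    have h1 := hP
    rw [← h, isColumnArray_snoc] at h1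
    exact ⟨⟨⟨_, h1.2.2⟩, Fin.init P, h1.1, rfl⟩, Subtype.ext h⟩

/-! ### The recursion for the counts -/

/-- The number of steps to the right from column `x` to column `y`. -/
theorem val_sub_eq_ite {N : ℕ} (x y : Fin N) :
    (y - x).val = if x ≤ y then y.val - x.val else N + y.val - x.val := by
  rw [Fin.sub_def]
  have hx := x.2
  have hy := y.2
  split_ifs with h <;> rw [Fin.le_def] at h
  · have : N - x.val + y.val = (y.val - x.val) + N := by omega
    simp only [this, Nat.add_mod_right]
    exact Nat.mod_eq_of_lt (by omega)
  · simp only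
    rw [Nat.mod_eq_of_lt (by omega)]
    omega

/-- Let `b i` be the closest box to the left of `b i'` among the boxes with index in `S`. Then
`b i'` is the first of these boxes weakly to the right of `x` if and only if `b i < x ≤ b i'`. As
`i < i'`, cyclic wrapping never occurs. -/
theorem forall_val_sub_le_iff {n N : ℕ} {b : Fin n → Fin N} (hb : StrictMono b) {i i' : Fin n}
    (h : i < i') {S : Set (Fin n)} (hi : i ∈ S) (hS : ∀ j ∈ S, j ≤ i ∨ i' ≤ j) (x : Fin N) :
    (∀ j ∈ S, (b i' - x).val ≤ (b j - x).val) ↔ x ∈ Ioc (b i) (b i') := by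
  have hbi := hb h
  rw [Finset.mem_Ioc]
  simp only [val_sub_eq_ite]
  constructor
  · intro H
    have := H i hi
    have h1 := (b i).2
    have h2 := (b i').2
    have h3 := x.2
    split_ifs at this <;> simp only [Fin.le_def, Fin.lt_def] at * <;> omega
  · rintro ⟨h1, h2⟩ j hj
    have h3 := (b i').2
    rcases hS j hj with h4 | h4
    · have := hb.monotone h4
      split_ifs <;> simp only [Fin.le_def, Fin.lt_def] at * <;> omega
    · have := hb.monotone h4
      split_ifs <;> simp only [Fin.le_def, Fin.lt_def] at * <;> omega

/-- The rows that produce `n ⋯ 2 1` at the columns `b` interlace with `b`. -/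
theorem feeds_iff {n N : ℕ} {b : Fin (n + 1) → Fin N} (hb : StrictMono b) (x : Fin n → Fin N) :
    Feeds x b ↔ ∀ i, x i ∈ Ioc (b i.castSucc) (b i.succ) := by
  refine forall_congr' fun i => ?_
  rw [← forall_val_sub_le_iff hb i.castSucc_lt_succ (S := Set.Iic i.succ)]
  · rfl
  · exact i.castSucc_lt_succ.le
  · intro j _
    rw [← not_lt, Fin.castSucc_lt_iff_succ_le]
    exact (em _).symm

/-- The rows that produce the word with two adjacent letters of `n ⋯ 2 1` interchanged, when the
larger of the two letters is not the new one. The smaller letter now sits at the left of the two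
boxes and comes from the gap to its left; the larger one skips that box, so that it may
come from two adjacent gaps. -/
theorem feeds_swap_iff {n N : ℕ} {b : Fin (n + 2) → Fin N} (hb : StrictMono b) (j : Fin n)
    (x : Fin (n + 1) → Fin N) :
    Feeds x (b ∘ Equiv.swap j.succ.castSucc j.succ.succ) ↔
      (∀ i, i ≠ j.castSucc → i ≠ j.succ → x i ∈ Ioc (b i.castSucc) (b i.succ)) ∧
      x j.castSucc ∈ Ioc (b j.castSucc.castSucc) (b j.succ.succ) ∧
      x j.succ ∈ Ioc (b j.castSucc.castSucc) (b j.castSucc.succ) := by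
  set τ := Equiv.swap j.succ.castSucc j.succ.succ with hτ
  -- In terms of positions, `S = {l | τ l ≤ i.succ}` indexes the boxes free at the `i`-th move.
  have hdef : Feeds x (b ∘ τ) ↔ ∀ i, ∀ l ∈ {l | τ l ≤ i.succ},
      (b (τ i.succ) - x i).val ≤ (b l - x i).val := by
    refine forall_congr' fun i => ⟨fun h l hl => ?_, fun h l hl => h (τ l) ?_⟩
    · simpa [hτ] using h (τ l) hl
    · simpa [hτ] using hl
  have hv : ∀ l : Fin (n + 2), ((τ l : Fin (n + 2)) : ℕ) =
      if (l : ℕ) = j + 1 then (j : ℕ) + 2 else if (l : ℕ) = j + 2 then (j : ℕ) + 1 else l := by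
    intro l
    rw [hτ, Equiv.swap_apply_def]
    simp only [Fin.ext_iff, Fin.val_castSucc, Fin.val_succ]
    split_ifs <;> simp [Fin.val_succ]
  rw [hdef]
  have key : ∀ (i : Fin (n + 1)) (a c : Fin (n + 2)), (c : ℕ) = τ i.succ → (a : ℕ) < c →
      ((τ a : Fin (n + 2)) : ℕ) ≤ i + 1 →
      (∀ l : Fin (n + 2), ((τ l : Fin (n + 2)) : ℕ) ≤ i + 1 → (l : ℕ) ≤ a ∨ (c : ℕ) ≤ l) →
      ((∀ l ∈ {l | τ l ≤ i.succ}, (b (τ i.succ) - x i).val ≤ (b l - x i).val) ↔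
        x i ∈ Ioc (b a) (b c)) := by
    intro i a c hc hac ha hS
    obtain rfl : c = τ i.succ := Fin.ext hc
    refine forall_val_sub_le_iff hb hac ?_ ?_ _
    · simpa [Fin.le_def] using ha
    · intro l hl
      exact hS l (by simpa [Fin.le_def] using hl)
  have h1 : ∀ i, i ≠ j.castSucc → i ≠ j.succ →
      ((∀ l ∈ {l | τ l ≤ i.succ}, (b (τ i.succ) - x i).val ≤ (b l - x i).val) ↔
        x i ∈ Ioc (b i.castSucc) (b i.succ)) := by
    intro i hi hi'
    rw [Ne, Fin.ext_iff, Fin.val_castSucc] at hi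
    rw [Ne, Fin.ext_iff, Fin.val_succ] at hi'
    apply key
    · rw [hv, Fin.val_succ]; split_ifs <;> omega
    · simp
    · rw [hv, Fin.val_castSucc]; split_ifs <;> omega
    · intro l
      rw [hv, Fin.val_castSucc, Fin.val_succ]; split_ifs <;> omega
  have h2 := key j.castSucc j.castSucc.castSucc j.succ.succ
    (by rw [hv]; simp) (by simp) (by rw [hv]; simp)
    (by intro l; rw [hv]; simp only [Fin.val_castSucc, Fin.val_succ]; split_ifs <;> omega)
  have h3 := key j.succ j.castSucc.castSucc j.castSucc.succ
    (by rw [hv]; simp) (by simp)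
    (by rw [hv]; simp only [Fin.val_castSucc, Fin.val_succ]; split_ifs <;> omega)
    (by intro l; rw [hv]; simp only [Fin.val_castSucc, Fin.val_succ]; split_ifs <;> omega)
  constructor
  · exact fun H => ⟨fun i hi hi' => (h1 i hi hi').1 (H i), h2.1 (H _), h3.1 (H _)⟩
  · rintro ⟨H1, H2, H3⟩ i
    by_cases hi : i = j.castSucc
    · subst hi; exact h2.2 H2
    by_cases hi' : i = j.succ
    · subst hi'; exact h3.2 H3
    exact (h1 i hi hi').2 (H1 i hi hi')

/-- The number of labelled multiline queues whose bottom word at the columns `y` is `n ⋯ 2 1`, or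
that word with the letters in the adjacent positions `i` and `i + 1` interchanged. -/
noncomputable def pairCount {n N : ℕ} (i : Fin n) (y : Fin (n + 1) → Fin N) : ℕ :=
  count (y ∘ Equiv.swap i.castSucc i.succ) + count y

/-- The columns in the `i`-th gap of `b`, including its right end. -/
abbrev gap {n N : ℕ} (b : Fin (n + 1) → Fin N) (i : Fin n) : Finset (Fin N) :=
  Ioc (b i.castSucc) (b i.succ)

/-- The gaps of `b`, with the `j`-th gap also in the place of the next one. -/
abbrev gapRepeat {n N : ℕ} (b : Fin (n + 2) → Fin N) (j : Fin n) :
    Fin (n + 1) → Finset (Fin N) :=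
  update (gap b) j.succ (gap b j.castSucc)

/-- Over a box with two equal sides, the sum is symmetrized by exchanging these two coordinates;
the diagonal does not contribute as `count` vanishes on non-injective rows. -/
theorem sum_pi_swap {n N : ℕ} {S : Fin n → Finset (Fin N)} {i j : Fin n} (hij : i ≠ j)
    (hS : S i = S j) :
    ∑ y ∈ Fintype.piFinset S, count (y ∘ Equiv.swap i j) =
      ∑ y ∈ Fintype.piFinset S with y i < y j, (count (y ∘ Equiv.swap i j) + count y) := by
  have hmem {y : Fin n → Fin N} (hy : y ∈ Fintype.piFinset S) :
      y ∘ Equiv.swap i j ∈ Fintype.piFinset S := by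
    rw [Fintype.mem_piFinset] at hy ⊢
    intro l
    rw [comp_apply, Equiv.swap_apply_def]
    split_ifs with h h'
    · rw [h, hS]; exact hy j
    · rw [h', ← hS]; exact hy i
    · exact hy l
  have h1 : ∑ y ∈ Fintype.piFinset S with y i < y j, count y =
      ∑ y ∈ Fintype.piFinset S with y j < y i, count (y ∘ Equiv.swap i j) := by
    refine sum_bij' (fun y _ => y ∘ Equiv.swap i j) (fun y _ => y ∘ Equiv.swap i j) ?_ ?_ ?_ ?_ ?_
    · intro y hy
      rw [mem_filter] at hy ⊢
      exact ⟨hmem hy.1, by simpa using hy.2⟩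
    · intro y hy
      rw [mem_filter] at hy ⊢
      exact ⟨hmem hy.1, by simpa using hy.2⟩
    all_goals intro y _; simp [comp_assoc, ← Equiv.coe_trans]
  rw [sum_add_distrib, h1, ← sum_filter_add_sum_filter_not _ (fun y => y i < y j)]
  congr 1
  symm
  refine sum_subset (fun y hy => ?_) fun y hy hy' => count_eq_zero fun hinj => ?_
  · rw [mem_filter] at hy ⊢
    exact ⟨hy.1, hy.2.not_gt⟩
  · rw [mem_filter] at hy hy'
    have h2 : y i = y j := le_antisymm (not_lt.1 fun h => hy' ⟨hy.1, h⟩) (not_lt.1 hy.2)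
    exact hij.symm (hinj (by simpa using h2))

theorem count_eq_sum_gap {n N : ℕ} {b : Fin (n + 1) → Fin N} (hb : StrictMono b) :
    count b = ∑ y ∈ Fintype.piFinset (gap b), count y := by
  classical
  rw [count_succ hb.injective]
  refine sum_congr ?_ fun _ _ => rfl
  ext y
  simp [feeds_iff hb]

/-- The recursion for `pairCount`, the transposition involving only labels present in the row above:
either the row above interlaces with `b`, or the boxes of the two exchanged labels lie in the same
gap, in either order. -/
theorem pairCount_succ {n N : ℕ} {b : Fin (n + 2) → Fin N} (hb : StrictMono b) (j : Fin n) :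
    pairCount j.succ b = ∑ y ∈ Fintype.piFinset (gap b), pairCount j y +
      ∑ y ∈ Fintype.piFinset (gapRepeat b j) with y j.castSucc < y j.succ, pairCount j y := by
  classical
  have hj : j.castSucc ≠ j.succ := j.castSucc_lt_succ.ne
  simp only [pairCount]
  rw [← sum_pi_swap hj (by simp [gapRepeat, hj]), sum_add_distrib, ← count_eq_sum_gap hb,
    count_succ (hb.injective.comp (Equiv.injective _)), add_right_comm _ (count b)]
  congr 1
  have hmem (y : Fin (n + 1) → Fin N) :
      y ∈ Fintype.piFinset (gap b) ∪ Fintype.piFinset (gapRepeat b j) ↔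
      Feeds (y ∘ Equiv.swap j.castSucc j.succ)
        (b ∘ Equiv.swap j.succ.castSucc j.succ.succ) := by
    rw [feeds_swap_iff hb, mem_union, Fintype.mem_piFinset, Fintype.mem_piFinset]
    simp only [comp_apply, Equiv.swap_apply_left, Equiv.swap_apply_right]
    have h1 : b j.castSucc.castSucc < b j.castSucc.succ := hb j.castSucc.castSucc_lt_succ
    have h2 : b j.succ.castSucc < b j.succ.succ := hb j.succ.castSucc_lt_succ
    have h3 : j.succ.castSucc = j.castSucc.succ := rfl
    constructor
    · rintro (h | h)
      · refine ⟨fun i hi hi' => ?_, ?_, h j.castSucc⟩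
        · rw [Equiv.swap_apply_of_ne_of_ne hi hi']
          exact h i
        · have := mem_Ioc.1 (h j.succ)
          exact mem_Ioc.2 ⟨h1.trans this.1, this.2⟩
      · refine ⟨fun i hi hi' => ?_, ?_, ?_⟩
        · rw [Equiv.swap_apply_of_ne_of_ne hi hi']
          simpa [gapRepeat, hi'] using h i
        · have := mem_Ioc.1 (by simpa only [gapRepeat, update_self] using h j.succ)
          exact mem_Ioc.2 ⟨this.1, this.2.trans h2.le⟩
        · simpa [gapRepeat, hj] using h j.castSucc
    · rintro ⟨H, h, h'⟩
      rw [mem_Ioc] at h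
      by_cases hy : y j.succ ≤ b j.castSucc.succ
      · refine Or.inr fun i => ?_
        by_cases hi' : i = j.succ
        · subst hi'
          rw [gapRepeat, update_self]
          exact mem_Ioc.2 ⟨h.1, hy⟩
        rw [gapRepeat, update_of_ne hi']
        by_cases hi : i = j.castSucc
        · subst hi; exact h'
        · have := H i hi hi'
          rwa [Equiv.swap_apply_of_ne_of_ne hi hi'] at this
      · refine Or.inl fun i => ?_
        by_cases hi' : i = j.succ
        · subst hi'
          exact mem_Ioc.2 ⟨not_le.1 hy, h.2⟩
        by_cases hi : i = j.castSucc
        · subst hi; exact h'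
        · have := H i hi hi'
          rwa [Equiv.swap_apply_of_ne_of_ne hi hi'] at this
  rw [← sum_union]
  · refine sum_bij' (fun y _ => y ∘ Equiv.swap j.castSucc j.succ)
      (fun y _ => y ∘ Equiv.swap j.castSucc j.succ) ?_ ?_ ?_ ?_ ?_
    · intro y hy
      rw [hmem, comp_assoc, ← Equiv.coe_trans]
      simpa using hy
    · intro y hy
      rw [hmem] at hy
      simpa using hy
    all_goals intro y _; simp [comp_assoc, ← Equiv.coe_trans]
  · rw [disjoint_left]
    intro y h h'
    rw [Fintype.mem_piFinset] at h h'
    have h1 := h j.succ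
    have h2 := h' j.succ
    simp only [gapRepeat, update_self, mem_Ioc] at h1 h2
    exact absurd h1.1 (not_lt.2 h2.2)

end MLQ

/-! ### Telescoping sums -/

section Telescoping

open Finset

/-- A discrete integration by parts for an alternating biadditive map `B`, where `u` is the backward
difference of `U` and `v` that of `u`. -/
theorem sum_Ioc_telescope {E M : Type*} [AddCommGroup E] [AddCommGroup M] (B : E → E → M)
    (sub_left : ∀ x x' z, B (x - x') z = B x z - B x' z)
    (sub_right : ∀ x z z', B x (z - z') = B x z - B x z') (self : ∀ x, B x x = 0)
    {U u v : ℕ → E} (hU : ∀ c, U (c + 1) - U c = u (c + 1)) (hu : ∀ c, u (c + 1) - u c = v (c + 1))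
    (a d : ℕ) :
    ∑ t ∈ Ioc a (a + d), B (U (t - 1) - U a) (v t) = B (U (a + d) - U a) (u (a + d)) := by
  induction d with
  | zero =>
    have h := sub_left 0 0 (u a)
    rw [sub_self, sub_self] at h
    simp [h]
  | succ d ih =>
    rw [← add_assoc, sum_Ioc_succ_top (by omega), ih, Nat.add_sub_cancel, ← hu, sub_right,
      add_sub_cancel, ← sub_eq_zero, ← sub_left, sub_sub_sub_cancel_right, ← neg_sub, hU]
    have h0 (z : E) : B 0 z = 0 := by simpa using sub_left 0 0 z
    have h := sub_left 0 (u (a + d + 1)) (u (a + d + 1))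
    rw [self, h0] at h
    simpa using h

theorem sum_Ioc_sub {E : Type*} [AddCommGroup E] {U u : ℕ → E}
    (hU : ∀ c, U (c + 1) - U c = u (c + 1)) {a d : ℕ} (h : a ≤ d) :
    ∑ t ∈ Ioc a d, u t = U d - U a := by
  induction d, h using Nat.le_induction with
  | base => simp
  | succ d h ih => rw [sum_Ioc_succ_top (by omega), ih, ← hU]; abel

theorem Fin.sum_Ioc_val {N : ℕ} {E : Type*} [AddCommMonoid E] (g : ℕ → E) (a d : Fin N) :
    ∑ t ∈ Ioc a d, g t = ∑ t ∈ Ioc (a : ℕ) d, g t := by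
  rw [← Fin.map_valEmbedding_Ioc, sum_map]; rfl

theorem Fin.sum_Ioo_val {N : ℕ} {E : Type*} [AddCommMonoid E] (g : ℕ → E) (a d : Fin N) :
    ∑ t ∈ Ioo a d, g t = ∑ t ∈ Ioo (a : ℕ) d, g t := by
  rw [← Fin.map_valEmbedding_Ioo, sum_map]; rfl

end Telescoping

namespace MLQ

open Finset Function

/-! ### The recursion for the determinants -/

/-- The row `binom (c + j) j` of the matrix `A`. -/
def fullRow (m c : ℕ) : Fin m → ℤ := fun j => ((c + j).choose j : ℤ)

/-- The row `binom (c + j - 1) (j - 1)` of the matrix `A`, which is the backward difference of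
`fullRow` in `c`. -/
def shiftedRow (m c : ℕ) : Fin m → ℤ := fun j =>
  if (j : ℕ) = 0 then 0 else ((c + ((j : ℕ) - 1)).choose ((j : ℕ) - 1) : ℤ)

/-- The row `binom (c + j + 1) (j + 1)`, whose backward difference in `c` is `fullRow`. -/
def sumRow (m c : ℕ) : Fin m → ℤ := fun j => ((c + (j + 1)).choose (j + 1) : ℤ)

theorem sumRow_sub (m c : ℕ) : sumRow m (c + 1) - sumRow m c = fullRow m (c + 1) := by
  funext j
  simp only [sumRow, fullRow, Pi.sub_apply]
  have : c + 1 + ((j : ℕ) + 1) = (c + 1 + j) + 1 := by ring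
  rw [this, Nat.choose_succ_succ', show c + 1 + (j : ℕ) = c + (j + 1) by ring]
  push_cast; ring

theorem fullRow_sub (m c : ℕ) : fullRow m (c + 1) - fullRow m c = shiftedRow m (c + 1) := by
  funext j
  simp only [shiftedRow, fullRow, Pi.sub_apply]
  rcases Nat.eq_zero_or_pos (j : ℕ) with h | h
  · simp [h]
  · obtain ⟨l, hl⟩ : ∃ l, (j : ℕ) = l + 1 := ⟨j - 1, by omega⟩
    rw [hl, if_neg (by omega), show c + 1 + (l + 1) = (c + 1 + l) + 1 by ring,
      Nat.choose_succ_succ', show c + 1 + l = c + (l + 1) by ring]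
    simp only [Nat.add_sub_cancel]
    rw [show c + 1 + l = c + (l + 1) by ring]
    push_cast; ring

/-- The `i`-th row of `A (n - j)`, as a function of the column `c` of the `i`-th box. -/
def rowOf {n : ℕ} (j : Fin n) (i : Fin (n + 1)) (c : ℕ) : Fin (n + 1) → ℤ :=
  if i ≤ j.castSucc then fullRow (n + 1) c else shiftedRow (n + 1) c

theorem det_A {n N : ℕ} (j : Fin n) (y : Fin (n + 1) → Fin N) :
    (A (n - j) y).det = Matrix.detRowAlternating fun i => rowOf j i (y i) := by
  change _ = Matrix.det _
  congr 1
  ext i l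
  have : (i : ℕ) < n + 1 - (n - j) ↔ i ≤ j.castSucc := by
    have := j.2
    rw [Fin.le_def, Fin.val_castSucc]
    omega
  simp only [A, Matrix.of_apply, rowOf, this]
  split_ifs <;> simp [fullRow, shiftedRow, *]

/-- The sum of the `i`-th row of `A (n - j)` over the `i`-th gap of `b`. -/
def gapSum {n N : ℕ} (j : Fin n) (b : Fin (n + 2) → Fin N) (i : Fin (n + 1)) : Fin (n + 1) → ℤ :=
  ∑ t ∈ gap b i, rowOf j i t

theorem gapSum_of_le {n N : ℕ} {j : Fin n} {b : Fin (n + 2) → Fin N} (hb : StrictMono b)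
    {i : Fin (n + 1)} (hi : i ≤ j.castSucc) :
    gapSum j b i = sumRow (n + 1) (b i.succ) - sumRow (n + 1) (b i.castSucc) := by
  simp only [gapSum, rowOf, if_pos hi]
  rw [Fin.sum_Ioc_val (fullRow (n + 1)),
    sum_Ioc_sub (sumRow_sub (n + 1)) (hb i.castSucc_lt_succ).le]

theorem gapSum_of_lt {n N : ℕ} {j : Fin n} {b : Fin (n + 2) → Fin N} (hb : StrictMono b)
    {i : Fin (n + 1)} (hi : j.castSucc < i) :
    gapSum j b i = fullRow (n + 1) (b i.succ) - fullRow (n + 1) (b i.castSucc) := by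
  simp only [gapSum, rowOf, if_neg hi.not_ge]
  rw [Fin.sum_Ioc_val (shiftedRow (n + 1)),
    sum_Ioc_sub (fullRow_sub (n + 1)) (hb i.castSucc_lt_succ).le]

theorem sum_det_gap {n N : ℕ} (j : Fin n) (b : Fin (n + 2) → Fin N) :
    ∑ y ∈ Fintype.piFinset (gap b), (A (n - j) y).det =
      Matrix.detRowAlternating (gapSum j b) := by
  simp only [det_A]
  exact (MultilinearMap.map_sum_finset (Matrix.detRowAlternating
    (R := ℤ) (n := Fin (n + 1))).toMultilinearMap (fun i (t : Fin N) => rowOf j i t) (gap b)).symm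

/-- The two rows `j` and `j + 1` are summed over `s < t` in the same gap: the sum over `s`
telescopes, and `sum_Ioc_telescope` evaluates the sum over `t`. -/
theorem sum_det_gapRepeat {n N : ℕ} (j : Fin n) {b : Fin (n + 2) → Fin N} (hb : StrictMono b) :
    ∑ y ∈ Fintype.piFinset (gapRepeat b j) with y j.castSucc < y j.succ, (A (n - j) y).det =
      Matrix.detRowAlternating
        (update (gapSum j b) j.succ (fullRow (n + 1) (b j.castSucc.succ))) := by
  have hj : j.castSucc ≠ j.succ := j.castSucc_lt_succ.ne
  let B : (Fin (n + 1) → ℤ) → (Fin (n + 1) → ℤ) → ℤ := fun x z =>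
    Matrix.detRowAlternating (update (update (gapSum j b) j.castSucc x) j.succ z)
  have hlt := hb j.castSucc.castSucc_lt_succ
  let J (t : Fin N) : Fin (n + 1) → Finset (Fin N) :=
    update (update (gap b) j.castSucc (Ioo (b j.castSucc.castSucc) t)) j.succ {t}
  have h1 (t : Fin N) (ht : t ∈ gap b j.castSucc) :
      ∑ y ∈ Fintype.piFinset (J t), (A (n - j) y).det =
        B (sumRow (n + 1) ((t : ℕ) - 1) - sumRow (n + 1) (b j.castSucc.castSucc))
          (shiftedRow (n + 1) t) := by
    simp only [det_A]
    refine (MultilinearMap.map_sum_finset (Matrix.detRowAlternating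
      (R := ℤ) (n := Fin (n + 1))).toMultilinearMap
      (fun i (t : Fin N) => rowOf j i t) (J t)).symm.trans ?_
    change Matrix.detRowAlternating _ = Matrix.detRowAlternating _
    congr 1
    funext i
    by_cases hi' : i = j.succ
    · subst hi'
      simp [J, rowOf, j.castSucc_lt_succ.not_ge]
    by_cases hi : i = j.castSucc
    · subst hi
      have h2 : Ioo (b j.castSucc.castSucc : ℕ) t = Ioc (b j.castSucc.castSucc : ℕ) (t - 1) := by
        ext s; simp only [mem_Ioo, mem_Ioc]; omega
      have h3 : (b j.castSucc.castSucc : ℕ) < t := (mem_Ioc.1 ht).1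
      simp only [J, update_of_ne hj, update_self, rowOf, le_refl, if_true]
      rw [Fin.sum_Ioo_val (fullRow (n + 1)), h2, sum_Ioc_sub (sumRow_sub (n + 1)) (by omega)]
    · simp only [J, update_of_ne hi, update_of_ne hi', gapSum]
  have h2 : ∑ y ∈ Fintype.piFinset (gapRepeat b j) with y j.castSucc < y j.succ,
      (A (n - j) y).det = ∑ t ∈ gap b j.castSucc, ∑ y ∈ Fintype.piFinset (J t),
        (A (n - j) y).det := by
    rw [← sum_fiberwise_of_maps_to (g := fun y => y j.succ) (t := gap b j.castSucc)]
    · refine sum_congr rfl fun t ht => sum_congr ?_ fun _ _ => rfl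
      ext y
      simp only [mem_filter, Fintype.mem_piFinset]
      constructor
      · rintro ⟨⟨h, h'⟩, rfl⟩ i
        by_cases hi' : i = j.succ
        · subst hi'; simp [J]
        have h4 := h i
        rw [gapRepeat, update_of_ne hi'] at h4
        by_cases hi : i = j.castSucc
        · subst hi
          simp only [J, update_of_ne hj, update_self]
          exact mem_Ioo.2 ⟨(mem_Ioc.1 h4).1, h'⟩
        · simpa only [J, update_of_ne hi, update_of_ne hi'] using h4
      · intro h
        have h3 := h j.succ
        have h4 := h j.castSucc
        simp only [J, update_of_ne hj, update_self, mem_singleton, mem_Ioo] at h3 h4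
        refine ⟨⟨fun i => ?_, h3 ▸ h4.2⟩, h3⟩
        by_cases hi' : i = j.succ
        · subst hi'; rw [h3, gapRepeat, update_self]; exact ht
        rw [gapRepeat, update_of_ne hi']
        by_cases hi : i = j.castSucc
        · subst hi
          exact mem_Ioc.2 ⟨h4.1, h4.2.le.trans (mem_Ioc.1 ht).2⟩
        · simpa only [J, update_of_ne hi, update_of_ne hi'] using h i
    · intro y hy
      rw [mem_filter, Fintype.mem_piFinset] at hy
      simpa [gapRepeat] using hy.1 j.succ
  rw [h2, sum_congr rfl h1, Fin.sum_Ioc_val fun t => B (sumRow (n + 1) (t - 1) -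
    sumRow (n + 1) (b j.castSucc.castSucc)) (shiftedRow (n + 1) t)]
  obtain ⟨d, hd⟩ := Nat.exists_eq_add_of_le (Fin.le_def.1 hlt.le)
  rw [hd, sum_Ioc_telescope B _ _ _ (sumRow_sub (n + 1)) (fullRow_sub (n + 1)), ← hd,
    ← gapSum_of_le hb le_rfl]
  · simp only [B, update_eq_self]
  · intro x x' z
    simp only [B, update_comm hj]
    exact AlternatingMap.map_update_sub _ _ _ _ _
  · intro x z z'
    exact AlternatingMap.map_update_sub _ _ _ _ _
  · intro x
    exact AlternatingMap.map_eq_zero_of_eq _ _ (by simp [hj]) hj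

/-- Subtract from each row its predecessor, except where the shifted rows begin, and expand along
the first column. -/
theorem det_A_eq_gapSum {n N : ℕ} (j : Fin n) {b : Fin (n + 2) → Fin N} (hb : StrictMono b) :
    (A (n - j) b).det = Matrix.detRowAlternating
      (update (gapSum j b) j.succ (fullRow (n + 1) (b j.succ.succ))) := by
  let M : Matrix (Fin (n + 2)) (Fin (n + 2)) ℤ := A (n - j) b
  let M' : Matrix (Fin (n + 2)) (Fin (n + 2)) ℤ := Matrix.of
    (Fin.cons (M 0) fun i => if i = j.succ then M i.succ else M i.succ - M i.castSucc)
  have hM (i : Fin (n + 2)) : M i = if (i : ℕ) ≤ j + 1 then fullRow (n + 2) (b i) else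
      shiftedRow (n + 2) (b i) := by
    funext l
    have : (i : ℕ) < n + 2 - (n - j) ↔ (i : ℕ) ≤ j + 1 := by
      have := j.2
      omega
    simp only [M, A, Matrix.of_apply, this]
    split_ifs <;> simp [fullRow, shiftedRow, *]
  have hdet : M.det = M'.det := by
    refine Matrix.det_eq_of_forall_row_eq_smul_add_pred (fun i => if i = j.succ then 0 else 1)
      (fun l => rfl) fun i l => ?_
    simp only [M', Matrix.of_apply, Fin.cons_succ]
    split_ifs <;> simp
  have hfs (c : ℕ) (l : Fin (n + 1)) : shiftedRow (n + 2) c l.succ = fullRow (n + 1) c l := by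
    simp [fullRow, shiftedRow]
  have hsf (c : ℕ) (l : Fin (n + 1)) : fullRow (n + 2) c l.succ = sumRow (n + 1) c l := by
    simp [fullRow, sumRow]
  have h0 (i : Fin (n + 1)) : M' i.succ 0 = 0 := by
    simp only [M', Matrix.of_apply, Fin.cons_succ]
    split_ifs with h
    · subst h
      rw [hM, if_neg (by simp)]
      simp [shiftedRow]
    · rw [Pi.sub_apply, hM, hM]
      rw [Fin.val_succ, Fin.val_castSucc]
      rcases lt_or_gt_of_ne h with h | h <;> rw [Fin.lt_def, Fin.val_succ] at h
      · rw [if_pos (by omega), if_pos (by omega)]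
        simp [fullRow]
      · rw [if_neg (by omega), if_neg (by omega)]
        simp [shiftedRow]
  have h00 : M' 0 0 = 1 := by
    change M 0 0 = 1
    rw [hM, if_pos (by simp)]
    simp [fullRow]
  change M.det = _
  rw [hdet, Matrix.det_succ_column_zero, Fin.sum_univ_succ]
  simp only [h0, h00, mul_zero, zero_mul, sum_const_zero, add_zero]
  simp only [Fin.val_zero, pow_zero, one_mul, Fin.succAbove_zero]
  change Matrix.det _ = Matrix.det _
  congr 1
  ext i l
  simp only [M', Matrix.submatrix_apply, Matrix.of_apply, Fin.cons_succ]
  by_cases h : i = j.succ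
  · subst h
    rw [if_pos rfl, update_self, hM, if_neg (by simp), hfs]
  · rw [if_neg h, update_of_ne h, Pi.sub_apply, hM, hM]
    rw [Fin.val_succ, Fin.val_castSucc]
    rcases lt_or_gt_of_ne h with h | h <;> rw [Fin.lt_def, Fin.val_succ] at h
    · rw [if_pos (by omega), if_pos (by omega), gapSum_of_le hb (by rw [Fin.le_def]; simp; omega),
        hsf, hsf, Pi.sub_apply]
    · rw [if_neg (by omega), if_neg (by omega), gapSum_of_lt hb (by rw [Fin.lt_def]; simp; omega),
        hfs, hfs, Pi.sub_apply]

/-- The determinants satisfy the recursion `pairCount_succ`. -/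
theorem det_A_succ {n N : ℕ} (j : Fin n) {b : Fin (n + 2) → Fin N} (hb : StrictMono b) :
    (A (n - j) b).det = ∑ y ∈ Fintype.piFinset (gap b), (A (n - j) y).det +
      ∑ y ∈ Fintype.piFinset (gapRepeat b j) with y j.castSucc < y j.succ, (A (n - j) y).det := by
  rw [sum_det_gap, sum_det_gapRepeat j hb, det_A_eq_gapSum j hb]
  have h := gapSum_of_lt hb j.castSucc_lt_succ
  have h' : fullRow (n + 1) (b j.succ.succ) =
      gapSum j b j.succ + fullRow (n + 1) (b j.castSucc.succ) := by
    rw [h]; exact (sub_add_cancel _ _).symm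
  rw [h', AlternatingMap.map_update_add, update_eq_self]

/-! ### The initial cases and the induction -/

/-- When the larger of the two exchanged letters is the new label, the last move must end at `b 0`
and not at `b 1`, so that it starts anywhere outside the gap between them. -/
theorem feeds_swap_zero_iff {n N : ℕ} {b : Fin (n + 2) → Fin N} (hb : StrictMono b)
    (x : Fin (n + 1) → Fin N) :
    Feeds x (b ∘ Equiv.swap 0 1) ↔ x 0 ∉ gap b 0 ∧ ∀ i : Fin n, x i.succ ∈ gap b i.succ := by
  have h01 : (0 : Fin (n + 2)) < 1 := Fin.zero_lt_one
  rw [Feeds, Fin.forall_fin_succ]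
  refine and_congr ?_ (forall_congr' fun i => ?_)
  · have h := forall_val_sub_le_iff hb h01 (S := {0}) rfl (fun j hj => Or.inl (le_of_eq hj)) (x 0)
    change _ ↔ x 0 ∉ Ioc (b 0) (b 1)
    rw [← h]
    simp only [Set.mem_singleton_iff, forall_eq, not_le, Fin.succ_zero_eq_one, comp_apply,
      Equiv.swap_apply_right]
    constructor
    · intro H
      refine lt_of_le_of_ne (by simpa using H 0 h01.le) fun e => ?_
      have hN : NeZero N := ⟨fun h => by subst h; exact (x 0).elim0⟩
      exact h01.ne (hb.injective (sub_left_injective (Fin.val_injective e)))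
    · intro H j hj
      obtain rfl | rfl : j = 0 ∨ j = 1 := by
        rw [Fin.le_def] at hj
        simp only [Fin.ext_iff, Fin.val_zero, Fin.val_one] at *
        omega
      · simpa using H.le
      · simp
  · rw [← forall_val_sub_le_iff hb i.succ.castSucc_lt_succ (S := Set.Iic i.succ.succ)]
    · have h1 : Equiv.swap (0 : Fin (n + 2)) 1 i.succ.succ = i.succ.succ :=
        Equiv.swap_apply_of_ne_of_ne (Fin.succ_ne_zero _) (by simp [Fin.ext_iff])
      have h2 (j : Fin (n + 2)) (hj : j ≤ i.succ.succ) : Equiv.swap 0 1 j ≤ i.succ.succ := by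
        rw [Equiv.swap_apply_def]
        split_ifs
        · simp [Fin.le_def]
        · simp
        · exact hj
      simp only [comp_apply, h1]
      exact ⟨fun h j hj => by simpa using h _ (h2 j hj), fun h j hj => h _ (h2 j hj)⟩
    · exact i.succ.castSucc_lt_succ.le
    · intro j _
      rw [← not_lt, Fin.castSucc_lt_iff_succ_le]
      exact (em _).symm

/-- If the exchange involves the new label, then the sum over both words removes the
condition on the last move. -/
theorem pairCount_zero {n N : ℕ} {b : Fin (n + 2) → Fin N} (hb : StrictMono b) :
    pairCount 0 b =
      ∑ x : Fin (n + 1) → Fin N with ∀ i : Fin n, x i.succ ∈ gap b i.succ, count x := by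
  classical
  have h1 (x : Fin (n + 1) → Fin N) : Feeds x b ↔
      x 0 ∈ gap b 0 ∧ ∀ i : Fin n, x i.succ ∈ gap b i.succ := by
    rw [feeds_iff hb, Fin.forall_fin_succ]
  rw [pairCount, count_succ hb.injective, count_succ (hb.injective.comp (Equiv.injective _)),
    ← sum_union]
  · refine sum_congr ?_ fun _ _ => rfl
    ext x
    simp only [mem_union, mem_filter, mem_univ, true_and]
    have h2 := feeds_swap_zero_iff hb x
    rw [h1]
    change Feeds x (b ∘ Equiv.swap 0 1) ∨ _ ↔ _
    rw [h2]
    tauto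
  · rw [disjoint_filter]
    intro x _ h h'
    exact ((feeds_swap_zero_iff hb x).1 h).1 ((h1 x).1 h').1

theorem count_one {N : ℕ} (y : Fin 1 → Fin N) : count y = 1 := by
  classical
  rw [count_succ (injective_of_subsingleton y), filter_true_of_mem fun _ _ i => i.elim0]
  simp [count_zero]

theorem pairCount_one {N : ℕ} {b : Fin 2 → Fin N} (hb : StrictMono b) :
    (pairCount 0 b : ℤ) = (N.choose 1 : ℤ) * (A 1 b).det := by
  rw [pairCount_zero hb, filter_true_of_mem fun _ _ i => i.elim0, Matrix.det_fin_two]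
  simp [count_one, A]

theorem count_two {N : ℕ} {q c : Fin N} (h : q ≠ c) :
    count ![q, c] = #{x : Fin N | (c - x).val < (q - x).val} := by
  classical
  have hinj : Injective ![q, c] := by
    intro i j
    fin_cases i <;> fin_cases j <;> simp [h, h.symm]
  rw [count_succ hinj]
  simp only [count_one, sum_const, smul_eq_mul, mul_one]
  refine card_equiv (Equiv.funUnique (Fin 1) (Fin N)) fun x => ?_
  have hN : NeZero N := ⟨fun h => by subst h; exact q.elim0⟩
  have hne : (q - x 0).val ≠ (c - x 0).val := fun e =>
    h (sub_left_injective (Fin.val_injective e))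
  simp only [mem_filter, mem_univ, true_and, Feeds, Equiv.funUnique_apply]
  simp [Fin.forall_fin_two, lt_iff_le_and_ne, hne.symm]

/-- Double counting: for a box `x` in the first row at distance `d` from `c`, there are
`N - 1 - d` columns `q` farther from `x` than `c`. -/
theorem sum_count_two {N : ℕ} (c : Fin N) : ∑ q, count ![q, c] = N.choose 2 := by
  have hN : NeZero N := ⟨fun h => by subst h; exact c.elim0⟩
  have h1 (q : Fin N) : count ![q, c] =
      ∑ x : Fin N, if (c - x).val < (q - x).val then 1 else 0 := by
    by_cases h : q = c
    · subst h
      rw [count_eq_zero fun hi => absurd (hi (a₁ := 0) (a₂ := 1) rfl) (by simp)]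
      simp
    · rw [count_two h, card_filter]
  have h2 (x : Fin N) :
      ∑ q : Fin N, (if (c - x).val < (q - x).val then 1 else 0) = N - 1 - (c - x).val := by
    rw [← Fin.card_Ioi]
    refine ((Equiv.subRight x).sum_comp fun q => if (c - x).val < q.val then 1 else 0).trans ?_
    rw [← card_filter]
    congr 1
    ext q
    simp
  simp only [h1]
  rw [sum_comm]
  simp only [h2]
  refine ((Equiv.subLeft c).sum_comp fun d => N - 1 - d.val).trans ?_
  rw [Fin.sum_univ_eq_sum_range fun d => N - 1 - d, sum_range_reflect fun d => d,
    sum_range_id, Nat.choose_two_right]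

theorem pairCount_two {N : ℕ} {b : Fin 3 → Fin N} (hb : StrictMono b) :
    (pairCount 0 b : ℤ) = (N.choose 2 : ℤ) * (A 2 b).det := by
  have h1 : pairCount 0 b = #(Ioc (b 1) (b 2)) * N.choose 2 := by
    rw [pairCount_zero hb, sum_filter, ← (finTwoArrowEquiv (Fin N)).symm.sum_comp,
      Fintype.sum_prod_type_right]
    simp only [Fin.forall_fin_one]
    have h2 (p : Fin N × Fin N) : (finTwoArrowEquiv (Fin N)).symm p = ![p.1, p.2] := rfl
    simp only [h2]
    change ∑ c, ∑ q, (if c ∈ Ioc (b 1) (b 2) then count ![q, c] else 0) = _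
    simp only [← ite_sum_zero, sum_count_two]
    rw [← sum_filter, filter_mem_eq_inter, univ_inter, sum_const, smul_eq_mul]
  have h3 : b 1 < b 2 := hb (by decide)
  have h4 : (b 1 : ℕ) ≤ b 2 := h3.le
  rw [h1, Fin.card_Ioc, Matrix.det_fin_three]
  simp [A]
  push_cast [h4]
  ring

theorem pairCount_eq {N k : ℕ} (hk : k = 1 ∨ k = 2) {n : ℕ} (i : Fin n) (hi : n - i = k)
    {b : Fin (n + 1) → Fin N} (hb : StrictMono b) :
    (pairCount i b : ℤ) = (N.choose k : ℤ) * (A k b).det := by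
  induction n with
  | zero => exact i.elim0
  | succ n ih =>
    cases i using Fin.cases with
    | zero =>
      simp only [Fin.val_zero, Nat.sub_zero] at hi
      rcases hk with rfl | rfl
      · obtain rfl : n = 0 := by omega
        exact pairCount_one hb
      · obtain rfl : n = 1 := by omega
        exact pairCount_two hb
    | succ j =>
      have hj : n - j = k := by rw [Fin.val_succ] at hi; omega
      have hlt (i : Fin n) : i.castSucc < i.succ := i.castSucc_lt_succ
      rw [pairCount_succ hb, ← hj, det_A_succ j hb, hj, mul_add, mul_sum, mul_sum]
      push_cast
      congr 1
      -- In both sums `y` is increasing, so that the induction hypothesis applies.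
      · refine sum_congr rfl fun y hy => ih j hj (Fin.strictMono_iff_lt_succ.2 fun i => ?_)
        rw [Fintype.mem_piFinset] at hy
        have h1 := (mem_Ioc.1 (hy i.castSucc)).2
        have h2 := (mem_Ioc.1 (hy i.succ)).1
        exact h1.trans_lt h2
      · refine sum_congr rfl fun y hy => ih j hj (Fin.strictMono_iff_lt_succ.2 fun i => ?_)
        rw [mem_filter, Fintype.mem_piFinset] at hy
        by_cases hij : i = j
        · subst hij; exact hy.2
        have h2 := hy.1 i.succ
        rw [gapRepeat, update_of_ne (by simpa using hij)] at h2
        have h1 := hy.1 i.castSucc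
        have hb' := hb.monotone
        by_cases h3 : i.castSucc = j.succ
        · rw [h3, gapRepeat, update_self] at h1
          rw [h3]
          refine (mem_Ioc.1 h1).2.trans_lt (lt_of_le_of_lt (hb' ?_) (mem_Ioc.1 h2).1)
          rw [Fin.ext_iff, Fin.val_castSucc, Fin.val_succ] at h3
          simp only [Fin.le_def, Fin.val_castSucc, Fin.val_succ]
          omega
        · rw [gapRepeat, update_of_ne h3] at h1
          exact (mem_Ioc.1 h1).2.trans_lt (mem_Ioc.1 h2).1

end MLQ

theorem theoremT (n N k : ℕ) (hk : k = 1 ∨ k = 2) (hkn : k < n) (hnN : n ≤ N)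
    (b : Fin n → Fin N) (hb : StrictMono b) :
    (MLQ.G (MLQ.s k hkn * MLQ.w₀ n) b : ℤ) =
      (N.choose k : ℤ) * (MLQ.A k b).det - (MLQ.G (MLQ.w₀ n) b : ℤ) := by
  obtain ⟨m, rfl⟩ : ∃ m, n = m + 1 := ⟨n - 1, by omega⟩
  let i : Fin m := ⟨m - k, by omega⟩
  have hi : m - (i : ℕ) = k := by simp only [i]; omega
  have h := MLQ.pairCount_eq hk i hi hb
  have h1 : MLQ.G (MLQ.w₀ (m + 1)) b = MLQ.count b := by
    rw [MLQ.G_eq_count]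
    congr 1
    funext l
    simp [MLQ.w₀]
  have h2 : MLQ.G (MLQ.s k hkn * MLQ.w₀ (m + 1)) b =
      MLQ.count (b ∘ Equiv.swap i.castSucc i.succ) := by
    rw [MLQ.G_eq_count]
    have e : MLQ.s k hkn = Equiv.swap i.castSucc.rev i.succ.rev := by
      rw [MLQ.s, Equiv.swap_comm]
      congr 1 <;> rw [Fin.ext_iff] <;> simp [Fin.val_rev] <;> omega
    congr 1
    funext l
    rw [Function.comp_apply]
    congr 1
    rw [Equiv.symm_apply_eq, e, Equiv.Perm.mul_apply, MLQ.w₀, Fin.revPerm_apply,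
      Fin.rev_injective.swap_apply, Equiv.swap_apply_self]
  rw [← h, MLQ.pairCount, h1, h2]
  push_cast
  ring
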